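/- Let $(X,\|\cdot\|_X)$ be a (real) Banach space, $(Y,d_Y)$ a metric space, and $K$ a compact subset of $Y$. Let $\mathcal{D}\colon K\to X$ be continuous, where $K$ carries the metric of $Y$. Let $B$ be a nonempty bounded closed convex subset of $X$, and let $\mathcal{I}\colon B\to K$ be continuous, where $B$ carries the metric induced by $\|\cdot\|_X$. Assume that $(\mathcal{D}\circ\mathcal{I})(B)\subset B$. Then $\mathcal{D}\circ\mathcal{I}$ has a fixed point in $B$, i.e. there exists $x\in B$ with $\mathcal{D}(\mathcal{I}(x))=x$. -/

import Mathlib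

open Set Metric Filter Topology MeasureTheory
open scoped NNReal

theorem ContinuousLinearMap.det_one_add_pos {E : Type*} [NormedAddCommGroup E] [NormedSpace ℝ E]
    [FiniteDimensional ℝ E] {B : E →L[ℝ] E} (hB : ‖B‖ < 1) : 0 < (1 + B).det := by
  by_contra! hneg
  have hcont : Continuous fun s : ℝ ↦ (1 + s • B).det :=
    ContinuousLinearMap.continuous_det.comp (by fun_prop)
  obtain ⟨s, hs, hs0⟩ : (0 : ℝ) ∈ (fun s : ℝ ↦ (1 + s • B).det) '' Icc 0 1 := by
    refine intermediate_value_Icc' zero_le_one hcont.continuousOn ⟨by simpa using hneg, ?_⟩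
    simp [ContinuousLinearMap.det]
  have hsB : ‖s • B‖ < 1 := by
    rw [norm_smul, Real.norm_of_nonneg hs.1]
    nlinarith [hs.2, norm_nonneg B]
  have hu : IsUnit (1 + s • B) := by
    have : ‖-(s • B)‖ < 1 := by rwa [norm_neg]
    have := isUnit_one_sub_of_norm_lt_one this
    rwa [sub_neg_eq_add] at this
  have h2 : IsUnit (LinearMap.det ((1 + s • B : E →L[ℝ] E) : E →ₗ[ℝ] E)) :=
    LinearMap.isUnit_det _ (hu.map (ContinuousLinearMap.toLinearMapRingHom (R₁ := ℝ) (M₁ := E)))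
  exact h2.ne_zero hs0

theorem LinearMap.exists_polynomial_eval_eq_det_one_add_smul {E : Type*} [AddCommGroup E]
    [Module ℝ E] [FiniteDimensional ℝ E] (A : E →ₗ[ℝ] E) :
    ∃ p : Polynomial ℝ, p.natDegree ≤ Module.finrank ℝ E ∧
      ∀ t : ℝ, p.eval t = LinearMap.det (1 + t • A) := by
  classical
  let b := Module.finBasis ℝ E
  let M := LinearMap.toMatrix b b A
  refine ⟨_, (Polynomial.natDegree_det_X_add_C_le M 1).trans (by simp), fun t ↦ ?_⟩
  rw [← Polynomial.coe_evalRingHom, RingHom.map_det, ← LinearMap.det_toMatrix b]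
  congr 1
  simp only [map_add, map_smul, LinearMap.toMatrix_one, M]
  ext i j
  by_cases hij : i = j <;> simp [hij] <;> ring

theorem Polynomial.eval_one_eq_sum_of_natDegree_le (n : ℕ) {δ : ℝ} (hδ : 0 < δ) :
    ∃ (v w : ℕ → ℝ), (∀ i ∈ Finset.range (n + 1), 0 < v i ∧ v i < δ) ∧
      ∀ p : Polynomial ℝ, p.natDegree ≤ n →
        p.eval 1 = ∑ i ∈ Finset.range (n + 1), w i * p.eval (v i) := by
  let v : ℕ → ℝ := fun i ↦ δ / (i + 2)
  have hv : Set.InjOn v (Finset.range (n + 1)) := by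
    intro i _ j _ hij
    simp only [v] at hij
    field_simp at hij
    have : (i : ℝ) = j := by linarith
    exact_mod_cast this
  refine ⟨v, fun i ↦ (Lagrange.basis (Finset.range (n + 1)) v i).eval 1, fun i _ ↦ ⟨by positivity,
    div_lt_self hδ (by linarith [(Nat.cast_nonneg i : (0 : ℝ) ≤ i)])⟩, fun p hp ↦ ?_⟩
  conv_lhs => rw [Lagrange.eq_interpolate (f := p) hv (by
    rw [Finset.card_range]
    exact Polynomial.degree_le_natDegree.trans_lt (by exact_mod_cast Nat.lt_succ_of_le hp))]
  simp [Lagrange.interpolate_apply, Polynomial.eval_finsetSum, mul_comm]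

theorem LipschitzOnWith.indicator_ball {E : Type*} [NormedAddCommGroup E] [NormedSpace ℝ E]
    {h : E → E} {K : ℝ≥0}
    (hh : LipschitzOnWith K h (closedBall 0 1)) (h0 : ∀ x, ‖x‖ = 1 → h x = 0) :
    LipschitzWith K ((ball (0 : E) 1).indicator h) := by
  have key : ∀ x ∈ ball (0 : E) 1, ∀ y ∉ ball (0 : E) 1, ‖h x‖ ≤ K * ‖x - y‖ := by
    intro x hx y hy
    obtain ⟨z, hz, hz1⟩ : (1 : ℝ) ∈ norm '' segment ℝ x y :=
      (convex_segment (𝕜 := ℝ) x y).isPreconnected.intermediate_value (left_mem_segment ℝ x y)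
        (right_mem_segment ℝ x y) continuous_norm.continuousOn
        ⟨(mem_ball_zero_iff.1 hx).le, by simpa using hy⟩
    have h1 := hh.dist_le_mul x (ball_subset_closedBall hx) z (by simp [hz1])
    rw [h0 z hz1, dist_zero_right] at h1
    refine h1.trans ?_
    gcongr
    have := dist_add_dist_of_mem_segment hz
    rw [← dist_eq_norm]
    linarith [dist_nonneg (x := z) (y := y)]
  refine LipschitzWith.of_dist_le_mul fun x y ↦ ?_
  rw [dist_eq_norm, dist_eq_norm]
  by_cases hx : x ∈ ball (0 : E) 1 <;> by_cases hy : y ∈ ball (0 : E) 1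
  · rw [indicator_of_mem hx, indicator_of_mem hy, ← dist_eq_norm, ← dist_eq_norm]
    exact hh.dist_le_mul _ (ball_subset_closedBall hx) _ (ball_subset_closedBall hy)
  · rw [indicator_of_mem hx, indicator_of_notMem hy, sub_zero]
    exact key x hx y hy
  · rw [indicator_of_notMem hx, indicator_of_mem hy, zero_sub, norm_neg, norm_sub_rev]
    exact key y hy x hx
  · rw [indicator_of_notMem hx, indicator_of_notMem hy, sub_zero, norm_zero]
    positivity

section Brouwer

variable {E : Type*} [NormedAddCommGroup E] [InnerProductSpace ℝ E] [FiniteDimensional ℝ E]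

theorem image_ball_add_smul_eq {h : E → E} {K : ℝ≥0} (hh : LipschitzWith K h)
    (h0 : ∀ x ∉ ball (0 : E) 1, h x = 0) {t : ℝ} (ht : 0 ≤ t) (htK : t * K < 1) :
    (fun x ↦ x + t • h x).Injective ∧ (fun x ↦ x + t • h x) '' ball 0 1 = ball 0 1 := by
  lift t to ℝ≥0 using ht
  have happ : ApproximatesLinearOn (fun x ↦ x + (t : ℝ) • h x)
      ((ContinuousLinearEquiv.refl ℝ E : E ≃L[ℝ] E) : E →L[ℝ] E) univ (t * K) := by
    intro x _ y _
    have : x + (t : ℝ) • h x - (y + (t : ℝ) • h y) -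
        ((ContinuousLinearEquiv.refl ℝ E : E ≃L[ℝ] E) : E →L[ℝ] E) (x - y)
        = (t : ℝ) • (h x - h y) := by
      simp only [ContinuousLinearEquiv.coe_refl, ContinuousLinearMap.coe_id', id_eq, smul_sub]
      abel
    rw [this, norm_smul, NNReal.coe_mul, mul_assoc]
    gcongr
    · simp
    · simpa [dist_eq_norm] using hh.dist_le_mul x y
  have hc : Subsingleton E ∨ t * K <
      ‖((ContinuousLinearEquiv.refl ℝ E).symm : E →L[ℝ] E)‖₊⁻¹ := by
    rcases subsingleton_or_nontrivial E with hE | hE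
    · exact Or.inl hE
    · right
      have : ‖((ContinuousLinearEquiv.refl ℝ E).symm : E →L[ℝ] E)‖₊ = 1 :=
        NNReal.eq (by simp)
      rw [this, inv_one]
      exact_mod_cast htK
  have hinj : (fun x ↦ x + (t : ℝ) • h x).Injective := by
    rw [← injOn_univ]; exact happ.injOn hc
  have hsurj := happ.surjective hc
  refine ⟨hinj, ?_⟩
  have hcompl : (fun x ↦ x + (t : ℝ) • h x) '' (ball 0 1)ᶜ = (ball 0 1)ᶜ := by
    rw [Set.image_congr (g := id) fun x hx ↦ by simp [h0 x hx], image_id]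
  rw [← compl_inj_iff, ← hcompl, image_compl_eq ⟨hinj, hsurj⟩]

theorem integral_det_one_add_smul_eq [MeasurableSpace E] [BorelSpace E] {h : E → E} {K : ℝ≥0}
    (hh : LipschitzWith K h)
    (h0 : ∀ x ∉ ball (0 : E) 1, h x = 0) {A : E → E →L[ℝ] E}
    (hA : ∀ x ∈ ball (0 : E) 1, HasFDerivAt h (A x) x) {t : ℝ} (ht : 0 ≤ t) (htK : t * K < 1) :
    ∫ x in ball (0 : E) 1, (1 + t • A x).det = volume.real (ball (0 : E) 1) := by
  obtain ⟨hinj, himg⟩ := image_ball_add_smul_eq hh h0 ht htK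
  have hd : ∀ x ∈ ball (0 : E) 1, HasFDerivWithinAt (fun x ↦ x + t • h x) (1 + t • A x)
      (ball 0 1) x := fun x hx ↦
    ((hasFDerivAt_id x).add ((hA x hx).const_smul t)).hasFDerivWithinAt
  have key := integral_image_eq_integral_abs_det_fderiv_smul volume measurableSet_ball hd
    hinj.injOn (fun _ ↦ (1 : ℝ))
  rw [himg] at key
  simp only [integral_const, smul_eq_mul, mul_one, measureReal_restrict_apply_univ] at key
  rw [key]
  refine setIntegral_congr_fun measurableSet_ball fun x hx ↦ (abs_of_pos ?_).symm
  refine ContinuousLinearMap.det_one_add_pos ?_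
  rw [norm_smul, Real.norm_of_nonneg ht]
  exact (mul_le_mul_of_nonneg_left ((hA x hx).le_of_lipschitz hh) ht).trans_lt htK

theorem not_exists_contDiffAt_retraction (r : E → E)
    (hr : ∀ x ∈ closedBall (0 : E) 1, ContDiffAt ℝ 1 r x)
    (hr1 : ∀ x ∈ closedBall (0 : E) 1, ‖r x‖ = 1) (hrS : ∀ x, ‖x‖ = 1 → r x = x) : False := by
  borelize E
  let A : E → E →L[ℝ] E := fun x ↦ fderiv ℝ r x - 1
  have hAc : ContinuousOn A (closedBall 0 1) := fun x hx ↦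
    (((hr x hx).fderiv_right (m := 0) le_rfl).continuousAt.sub
      continuousAt_const).continuousWithinAt
  have hdr : ∀ x ∈ closedBall (0 : E) 1, HasFDerivAt (fun x ↦ r x - x) (A x) x := fun x hx ↦
    ((hr x hx).differentiableAt one_ne_zero).hasFDerivAt.sub (hasFDerivAt_id x)
  obtain ⟨C, hC⟩ := (isCompact_closedBall (0 : E) 1).exists_bound_of_continuousOn hAc
  have hLip : LipschitzOnWith C.toNNReal (fun x ↦ r x - x) (closedBall 0 1) :=
    (convex_closedBall (0 : E) 1).lipschitzOnWith_of_nnnorm_hasFDerivWithin_le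
      (fun x hx ↦ (hdr x hx).hasFDerivWithinAt)
      fun x hx ↦ by
        rw [← NNReal.coe_le_coe, coe_nnnorm]
        exact (hC x hx).trans (Real.le_coe_toNNReal C)
  set K := C.toNNReal
  have hLip' := hLip.indicator_ball fun x hx ↦ by simp [hrS x hx]
  have hA : ∀ x ∈ ball (0 : E) 1,
      HasFDerivAt ((ball (0 : E) 1).indicator fun x ↦ r x - x) (A x) x := fun x hx ↦
    (hdr x (ball_subset_closedBall hx)).congr_of_eventuallyEq <| by
      filter_upwards [isOpen_ball.mem_nhds hx] with y hy using indicator_of_mem hy _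
  have hvol : ∀ t : ℝ, 0 ≤ t → t * K < 1 →
      ∫ x in ball (0 : E) 1, (1 + t • A x).det = volume.real (ball (0 : E) 1) := fun t ↦
    integral_det_one_add_smul_eq hLip' (fun x hx ↦ indicator_of_notMem hx _) hA
  have hint : ∀ t : ℝ, IntegrableOn (fun x ↦ (1 + t • A x).det) (ball (0 : E) 1) := fun t ↦
    ((ContinuousLinearMap.continuous_det.comp_continuousOn
      (continuousOn_const.add (hAc.const_smul t))).integrableOn_compact
      (isCompact_closedBall 0 1)).mono_set ball_subset_closedBall
  obtain ⟨v, w, hv, hw⟩ := Polynomial.eval_one_eq_sum_of_natDegree_le (Module.finrank ℝ E)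
    (δ := 1 / (K + 1)) (by positivity)
  have hsum : ∀ x, (1 + (1 : ℝ) • A x).det =
      ∑ i ∈ Finset.range (Module.finrank ℝ E + 1), w i * (1 + v i • A x).det := fun x ↦ by
    obtain ⟨p, hp, hpe⟩ := LinearMap.exists_polynomial_eval_eq_det_one_add_smul (A x : E →ₗ[ℝ] E)
    have := hw p hp
    simp only [hpe] at this
    exact this
  have hw1 : ∑ i ∈ Finset.range (Module.finrank ℝ E + 1), w i = 1 := by
    simpa using (hw 1 (by simp)).symm
  have htot : ∫ x in ball (0 : E) 1, (1 + (1 : ℝ) • A x).det = volume.real (ball (0 : E) 1) := by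
    simp_rw [hsum]
    rw [integral_finsetSum _ fun i _ ↦ (hint (v i)).const_mul (w i)]
    simp_rw [integral_const_mul]
    rw [Finset.sum_congr rfl fun i hi ↦ by
      rw [hvol (v i) (hv i hi).1.le (by
        have := (hv i hi).2
        rw [lt_div_iff₀ (by positivity)] at this
        nlinarith [(hv i hi).1])], ← Finset.sum_mul, hw1, one_mul]
  have hzero : ∀ x ∈ ball (0 : E) 1, (1 + (1 : ℝ) • A x).det = 0 := fun x hx ↦ by
    by_contra hne
    have hx' := ball_subset_closedBall hx
    have hAx : 1 + (1 : ℝ) • A x = fderiv ℝ r x := by simp [A]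
    rw [hAx] at hne
    have hd := ((hr x hx').differentiableAt one_ne_zero).hasFDerivAt
    have hconst : HasFDerivAt (fun y ↦ inner ℝ (r y) (r y)) (0 : E →L[ℝ] ℝ) x :=
      (hasFDerivAt_const (1 : ℝ) x).congr_of_eventuallyEq <| by
        filter_upwards [isOpen_ball.mem_nhds hx] with y hy
        rw [real_inner_self_eq_norm_sq, hr1 y (ball_subset_closedBall hy), one_pow]
    have huniq := (hd.inner ℝ hd).unique hconst
    obtain ⟨u, hu⟩ := (LinearEquiv.ofIsUnitDet (f := (fderiv ℝ r x : E →ₗ[ℝ] E))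
      (v := Module.finBasis ℝ E) (v' := Module.finBasis ℝ E)
      (by rw [LinearMap.det_toMatrix]; exact isUnit_iff_ne_zero.2 hne)).surjective (r x)
    have hu' : fderiv ℝ r x u = r x := hu
    have := congrArg (fun L : E →L[ℝ] ℝ ↦ L u) huniq
    simp [hu', hr1 x hx'] at this
  rw [setIntegral_congr_fun measurableSet_ball hzero, integral_zero] at htot
  exact (ENNReal.toReal_pos (measure_ball_pos volume (0 : E) one_pos).ne'
    measure_ball_lt_top.ne).ne htot

theorem exists_fixedPoint_of_contDiff (f : E → E) (hf : ContDiff ℝ 1 f) (hf1 : ∀ x, ‖f x‖ ≤ 1) :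
    ∃ x, f x = x := by
  by_contra! hne
  let u : E → E := fun x ↦ x - f x
  have hu : ContDiff ℝ 1 u := contDiff_id.sub hf
  have hu0 : ∀ x, 0 < ‖u x‖ ^ 2 := fun x ↦ by
    have : u x ≠ 0 := sub_ne_zero.2 (hne x).symm
    positivity
  let b : E → ℝ := fun x ↦ inner ℝ x (u x)
  let d : E → ℝ := fun x ↦ b x ^ 2 + ‖u x‖ ^ 2 * (1 - ‖x‖ ^ 2)
  have hbpos : ∀ x, ‖x‖ = 1 → 0 < b x := fun x hx ↦ by
    have h1 : b x = 1 - inner ℝ x (f x) := by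
      simp [b, u, inner_sub_right, hx]
    have h2 : inner ℝ x (f x) < (1 : ℝ) := by
      have h3 := real_inner_le_norm x (f x)
      rw [hx, one_mul] at h3
      refine lt_of_le_of_ne (h3.trans (hf1 x)) fun h ↦ hne x ?_
      have hfx : ‖f x‖ = 1 := le_antisymm (hf1 x) (h ▸ h3)
      exact ((inner_eq_one_iff_of_norm_eq_one hx hfx).1 h).symm
    linarith
  have hdpos : ∀ x ∈ closedBall (0 : E) 1, 0 < d x := fun x hx ↦ by
    rw [mem_closedBall_zero_iff] at hx
    rcases hx.lt_or_eq with h | h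
    · have : 0 < 1 - ‖x‖ ^ 2 := by nlinarith [norm_nonneg x]
      have := mul_pos (hu0 x) this
      positivity
    · have := hbpos x h
      simp only [d, h]
      norm_num
      positivity
  let l : E → ℝ := fun x ↦ (√(d x) - b x) / ‖u x‖ ^ 2
  have hb : ContDiff ℝ 1 b := contDiff_id.inner ℝ hu
  have hd : ContDiff ℝ 1 d :=
    (hb.pow 2).add ((hu.norm_sq ℝ).mul (contDiff_const.sub (contDiff_id.norm_sq ℝ)))
  refine not_exists_contDiffAt_retraction (fun x ↦ x + l x • u x) (fun x hx ↦ ?_)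
    (fun x hx ↦ ?_) fun x hx ↦ ?_
  · exact contDiffAt_id.add ((((hd.contDiffAt.sqrt (hdpos x hx).ne').sub hb.contDiffAt).div
      (hu.norm_sq ℝ).contDiffAt (hu0 x).ne').smul hu.contDiffAt)
  · have h1 : ‖x + l x • u x‖ ^ 2 = 1 := by
      rw [norm_add_sq_real, norm_smul, inner_smul_right, mul_pow, Real.norm_eq_abs, sq_abs]
      change ‖x‖ ^ 2 + 2 * (l x * b x) + l x ^ 2 * ‖u x‖ ^ 2 = 1
      have h2 := Real.sq_sqrt (hdpos x hx).le
      have h3 : l x * ‖u x‖ ^ 2 = √(d x) - b x := div_mul_cancel₀ _ (hu0 x).ne'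
      have h4 : √(d x) = l x * ‖u x‖ ^ 2 + b x := by linarith
      rw [h4] at h2
      refine mul_left_cancel₀ (hu0 x).ne' ?_
      simp only [d] at h2
      linarith
    exact (pow_eq_one_iff_of_nonneg (norm_nonneg _) two_ne_zero).1 h1
  · have : l x = 0 := by
      simp [l, d, hx, Real.sqrt_sq (hbpos x hx).le]
    simp [this]

theorem exists_fixedPoint_of_norm_le_one (f : E → E) (hf : Continuous f) (hf1 : ∀ x, ‖f x‖ ≤ 1) :
    ∃ x, f x = x := by
  by_contra! hne
  obtain ⟨x₀, -, hx₀⟩ := (isCompact_closedBall (0 : E) 1).exists_isMinOn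
    ⟨0, by simp⟩ (f := fun x ↦ ‖f x - x‖) (by fun_prop)
  set δ := ‖f x₀ - x₀‖
  have hδ : 0 < δ := norm_pos_iff.2 (sub_ne_zero.2 (hne x₀))
  obtain ⟨g, hg, hgf, -⟩ := hf.exists_contDiff_approx 1 (ε := fun _ ↦ δ / 3) continuous_const
    (fun _ ↦ by positivity)
  have hg1 : ∀ x, ‖(1 + δ / 3)⁻¹ • g x‖ ≤ 1 := fun x ↦ by
    rw [norm_smul, Real.norm_of_nonneg (by positivity), inv_mul_le_one₀ (by positivity)]
    have := norm_le_norm_add_norm_sub' (g x) (f x)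
    have h2 := hgf x
    rw [dist_eq_norm] at h2
    linarith [hf1 x]
  obtain ⟨x, hx⟩ := exists_fixedPoint_of_contDiff (fun x ↦ (1 + δ / 3)⁻¹ • g x)
    (contDiff_const.smul hg) hg1
  have hx1 : ‖x‖ ≤ 1 := hx ▸ hg1 x
  have hgx : g x = (1 + δ / 3) • x := by
    rw [eq_comm, ← hx, smul_inv_smul₀ (by positivity)]
    simp only [hx]
  have hmin : δ ≤ ‖f x - x‖ := hx₀ (by simpa using hx1)
  have h1 : ‖g x - x‖ ≤ δ / 3 := by
    rw [hgx, add_smul, one_smul, add_sub_cancel_left, norm_smul, Real.norm_of_nonneg (by positivity)]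
    exact mul_le_of_le_one_right (by positivity) hx1
  have h2 := hgf x
  rw [dist_eq_norm] at h2
  have h3 := norm_sub_le_norm_sub_add_norm_sub (f x) (g x) x
  rw [norm_sub_rev (f x) (g x)] at h3
  linarith

end Brouwer

theorem exists_fixedPoint_of_norm_le {E : Type*} [NormedAddCommGroup E] [InnerProductSpace ℝ E]
    [FiniteDimensional ℝ E] (f : E → E) (hf : Continuous f) {R : ℝ} (hf1 : ∀ x, ‖f x‖ ≤ R) :
    ∃ x, f x = x := by
  have hR : 0 < max R 1 := by positivity
  obtain ⟨x, hx⟩ := exists_fixedPoint_of_norm_le_one (fun x ↦ (max R 1)⁻¹ • f (max R 1 • x))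
    (by fun_prop) fun x ↦ by
      rw [norm_smul, Real.norm_of_nonneg (by positivity), inv_mul_le_one₀ hR]
      exact (hf1 _).trans (le_max_left _ _)
  exact ⟨max R 1 • x, by conv_rhs => rw [← hx, smul_inv_smul₀ hR.ne']⟩

section Schauder

variable {X : Type*} [NormedAddCommGroup X] [NormedSpace ℝ X]

theorem Convex.exists_dist_le_of_totallyBounded {B : Set X} (hB : Convex ℝ B)
    (hne : B.Nonempty) {T : B → X} (hT : Continuous T) (hTB : range T ⊆ B)
    (htb : TotallyBounded (range T)) {ε : ℝ} (hε : 0 < ε) : ∃ x : B, dist (T x) x ≤ ε := by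
  obtain ⟨s, hsT, hsf, hcov⟩ := finite_approx_of_totallyBounded htb ε hε
  have := hsf.fintype
  obtain ⟨b, hb⟩ := hne
  let φ : s → X → ℝ := fun i x ↦ max 0 (ε - dist x i)
  have hφ0 : ∀ i x, 0 ≤ φ i x := fun i x ↦ le_max_left _ _
  have hφc : ∀ i, Continuous (φ i) := fun i ↦ by fun_prop
  let Φ : X → ℝ := fun x ↦ ∑ i, φ i x
  have hΦ : ∀ x ∈ range T, 0 < Φ x := fun x hx ↦ by
    obtain ⟨i, hi, hxi⟩ := mem_iUnion₂.1 (hcov hx)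
    refine Finset.sum_pos' (fun i _ ↦ hφ0 i x) ⟨⟨i, hi⟩, Finset.mem_univ _, ?_⟩
    exact lt_max_of_lt_right (sub_pos.2 hxi)
  let σ : EuclideanSpace ℝ s → ℝ := fun v ↦ ∑ i, max (v i) 0
  have hσ0 : ∀ v, 0 ≤ σ v := fun v ↦ Finset.sum_nonneg fun i _ ↦ le_max_right _ _
  have hσc : Continuous σ := by fun_prop
  have hm : ∀ v, 0 < max (σ v) 1 := fun v ↦ by positivity
  let ℓ : EuclideanSpace ℝ s → X := fun v ↦
    (max (σ v) 1)⁻¹ • (∑ i, max (v i) 0 • (i : X) + max (σ v) 1 • b - σ v • b)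
  have hℓc : Continuous ℓ := by
    have : Continuous fun v ↦ (max (σ v) 1)⁻¹ :=
      (hσc.max continuous_const).inv₀ fun v ↦ (hm v).ne'
    fun_prop
  have hℓB : ∀ v, ℓ v ∈ B := fun v ↦ by
    have h1 : (∑ i, ((max (σ v) 1)⁻¹ * max (v i) 0) • (i : X)) +
        ((max (σ v) 1)⁻¹ * (max (σ v) 1 - σ v)) • b = ℓ v := by
      simp only [ℓ, mul_smul, ← Finset.smul_sum, sub_smul, ← smul_add, add_sub_assoc]
    have h2 := hB.sum_mem (t := (Finset.univ : Finset (Option s)))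
      (w := fun o ↦ o.elim ((max (σ v) 1)⁻¹ * (max (σ v) 1 - σ v))
        fun i ↦ (max (σ v) 1)⁻¹ * max (v i) 0)
      (z := fun o ↦ o.elim b fun i ↦ (i : X)) ?_ ?_ ?_
    · rw [Fintype.sum_option, add_comm] at h2
      exact h1 ▸ h2
    · rintro (_ | i) -
      · exact mul_nonneg (inv_nonneg.2 (hm v).le) (sub_nonneg.2 (le_max_left _ _))
      · exact mul_nonneg (inv_nonneg.2 (hm v).le) (le_max_right _ _)
    · rw [Fintype.sum_option]
      simp only [Option.elim, ← Finset.mul_sum, ← mul_add]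
      rw [show ∑ i, max (v i) 0 = σ v from rfl, sub_add_cancel, inv_mul_cancel₀ (hm v).ne']
    · rintro (_ | i) -
      · exact hb
      · exact hTB (hsT i.2)
  let τ : EuclideanSpace ℝ s → X := fun v ↦ T ⟨ℓ v, hℓB v⟩
  have hτc : Continuous τ := hT.comp (hℓc.subtype_mk _)
  have hτΦ : ∀ v, 0 < Φ (τ v) := fun v ↦ hΦ _ (mem_range_self _)
  let F : EuclideanSpace ℝ s → EuclideanSpace ℝ s := fun v ↦ WithLp.toLp 2 fun i ↦ φ i (τ v) / Φ (τ v)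
  have hFc : Continuous F := by
    refine (PiLp.continuous_toLp 2 _).comp (continuous_pi fun i ↦ ?_)
    exact ((hφc i).comp hτc).div (continuous_finsetSum _ fun i _ ↦ (hφc i).comp hτc)
      fun v ↦ (hτΦ v).ne'
  have hF0 : ∀ v i, 0 ≤ F v i := fun v i ↦ div_nonneg (hφ0 _ _) (hτΦ v).le
  have hF1 : ∀ v, ∑ i, F v i = 1 := fun v ↦ by
    simp only [F, ← Finset.sum_div]
    exact div_self (hτΦ v).ne'
  obtain ⟨v, hv⟩ := exists_fixedPoint_of_norm_le F hFc (R := 1) fun v ↦ by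
    rw [← sq_le_one_iff₀ (norm_nonneg _), EuclideanSpace.norm_sq_eq, ← hF1 v]
    refine Finset.sum_le_sum fun i _ ↦ ?_
    rw [Real.norm_of_nonneg (hF0 v i), sq]
    refine mul_le_of_le_one_left (hF0 v i) ?_
    rw [← hF1 v]
    exact Finset.single_le_sum (fun j _ ↦ hF0 v j) (Finset.mem_univ i)
  have hv0 : ∀ i, max (v i) 0 = v i := fun i ↦ max_eq_left (hv ▸ hF0 v i)
  have hv1 : ∑ i, v i = 1 := by have := hF1 v; rwa [hv] at this
  have hσv : σ v = 1 := by simp only [σ, hv0, hv1]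
  have hℓv : ℓ v = ∑ i, v i • (i : X) := by simp [ℓ, hσv, hv0]
  refine ⟨⟨ℓ v, hℓB v⟩, ?_⟩
  change dist (τ v) (ℓ v) ≤ ε
  rw [dist_comm, ← mem_closedBall, hℓv]
  -- points whose weight does not vanish are close to `τ v`
  have hmem := (convex_closedBall (τ v) ε).sum_mem (t := Finset.univ.filter fun i ↦ v i ≠ 0)
    (w := fun i ↦ v i) (z := fun i : s ↦ (i : X)) (fun i _ ↦ hv ▸ hF0 v i)
    (by rw [Finset.sum_filter_ne_zero, hv1]) fun i hi ↦ by
      by_contra hfar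
      refine (Finset.mem_filter.1 hi).2 ?_
      rw [mem_closedBall', not_le] at hfar
      rw [← hv]
      simp [F, φ, max_eq_left (sub_nonpos.2 hfar.le)]
  rwa [Finset.sum_filter_of_ne fun i _ h ↦ left_ne_zero_of_smul h] at hmem

theorem Convex.exists_fixedPoint_of_range_subset_isCompact {B : Set X} (hB : Convex ℝ B)
    (hne : B.Nonempty) (hBc : IsClosed B) {T : B → X} (hT : Continuous T) (hTB : range T ⊆ B)
    {C : Set X} (hC : IsCompact C) (hTC : range T ⊆ C) : ∃ x : B, T x = x := by
  choose x hx using fun n : ℕ ↦ hB.exists_dist_le_of_totallyBounded hne hT hTB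
    (hC.totallyBounded.subset hTC) (Nat.one_div_pos_of_nat (α := ℝ) (n := n))
  obtain ⟨z, -, ψ, hψ, hz⟩ := hC.tendsto_subseq fun n ↦ hTC (mem_range_self (x n))
  have hxz : Tendsto (fun n ↦ (x (ψ n) : X)) atTop (𝓝 z) := by
    refine hz.congr_dist ?_
    exact squeeze_zero (fun _ ↦ dist_nonneg) (fun n ↦ hx (ψ n))
      (tendsto_one_div_add_atTop_nhds_zero_nat.comp hψ.tendsto_atTop)
  have hzB : z ∈ B := hBc.mem_of_tendsto hxz (Eventually.of_forall fun n ↦ (x (ψ n)).2)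
  refine ⟨⟨z, hzB⟩, tendsto_nhds_unique ((hT.tendsto ⟨z, hzB⟩).comp ?_) hz⟩
  exact tendsto_subtype_rng.2 hxz

end Schauder

theorem lemma1p3 {X : Type*} [NormedAddCommGroup X] [NormedSpace ℝ X] [CompleteSpace X]
    {Y : Type*} [MetricSpace Y]
    (K : Set Y) (hK : IsCompact K)
    (D : K → X) (hD : Continuous D)
    (B : Set X) (hBne : B.Nonempty) (hBbdd : Bornology.IsBounded B) (hBclosed : IsClosed B)
    (hBconv : Convex ℝ B)
    (I : B → K) (hI : Continuous I)
    (hDI : Set.range (D ∘ I) ⊆ B) :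
    ∃ x : B, (D ∘ I) x = (x : X) := by

  exact hBconv.exists_fixedPoint_of_range_subset_isCompact hBne hBclosed (hD.comp hI) hDI
    (C := range D) (by have := isCompact_iff_compactSpace.1 hK; exact isCompact_range hD)
    (range_comp_subset_range I D)
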